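/- For a positive integer $n$ and $0<p<1$, let $\mu_p$ denote the $p$-biased probability measure on the subsets of $[n]=\{1,\dots,n\}$ (identified with $\{0,1\}^n$), that is, $\mu_p(\mathcal{A})=\sum_{A\in\mathcal{A}}p^{|A|}(1-p)^{n-|A|}$ for every family $\mathcal{A}$ of subsets of $[n]$. Given a set $L$ of nonnegative integers and two families $\mathcal{F},\mathcal{G}$ of subsets of $[n]$, we say that the cross intersections of $\mathcal{F}$ and $\mathcal{G}$ forbid $L$ if $|A\cap B|\notin L$ for every $A\in\mathcal{F}$ and every $B\in\mathcal{G}$. Lemma 3.3. Let $n$ be a positive integer, let $p,p'$ be real numbers with $0<p\le p'\le 1-p$ and $p\le\frac12$, and let $\alpha$ be a positive integer with $\alpha\le pn$. Let $\mathcal{F},\mathcal{G}$ be two families of subsets of $[n]$. (i) If the cross intersections of $\mathcal{F}$ and $\mathcal{G}$ forbid $\{k\in\mathbb{Z}:0\le k\le\alpha\}$, then \[ \mu_p(\mathcal{F})\,\mu_{p'}(\mathcal{G})\le\exp\Big(-\frac{\alpha^2}{24\,p(1-p)\,n}\Big). \] (ii) If the cross intersections of $\mathcal{F}$ and $\mathcal{G}$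 forbid $\{k\in\mathbb{Z}:pn-\alpha\le k\le n\}$, then \[ \mu_p(\mathcal{F})\,\mu_{p'}(\mathcal{G})\le 2\exp\Big(-\frac{\alpha^2}{24\,p(1-p)\,n}\Big). \] -/

import Mathlib

/-- The `p`-biased measure `μ_p(𝓐) = ∑_{A ∈ 𝓐} p^|A| (1-p)^(n-|A|)` of a family `𝓐` of subsets
of an `n`-element set; points of `{0,1}^n` are identified with subsets of `Fin n`. -/
noncomputable def biasedMeasure {n : ℕ} (p : ℝ) (𝓐 : Finset (Finset (Fin n))) : ℝ :=
  ∑ A ∈ 𝓐, p ^ A.card * (1 - p) ^ (n - A.card)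

/-- The cross intersections of `𝓕` and `𝓖` forbid `L`: `|A ∩ B| ∉ L` for all `A ∈ 𝓕`, `B ∈ 𝓖`. -/
def Forbid (n : ℕ) (L : Set ℕ) (𝓕 𝓖 : Finset (Finset (Fin n))) : Prop :=
  ∀ A ∈ 𝓕, ∀ B ∈ 𝓖, (A ∩ B).card ∉ L

/-! Both parts reduce to families with `|A \ B| ≥ t` throughout. For indicators of such families and
`M = exp s`, the product is at most `exp (-s t) * M ^ |A \ B|`. A two-point inequality tensorizes
this pointwise bound over coordinates (`biasedExp_mul_biasedExp_le`), and choosing `s` gives a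
Gaussian tail. For (i), complement `𝓖`, since `A ∩ B = A \ Bᶜ`. For (ii), the small members of `𝓕`
have small measure by Chernoff, while the others have large `|A \ B|`. -/

/-- The expectation of `f` under the `p`-biased measure on the subsets of `S`. -/
noncomputable def biasedExp {ι : Type*} [DecidableEq ι] (p : ℝ) (S : Finset ι)
    (f : Finset ι → ℝ) : ℝ :=
  ∑ A ∈ S.powerset, p ^ A.card * (1 - p) ^ (S.card - A.card) * f A

theorem biasedExp_insert {ι : Type*} [DecidableEq ι] (p : ℝ) {a : ι} {S : Finset ι} (ha : a ∉ S)
    (f : Finset ι → ℝ) :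
    biasedExp p (insert a S) f =
      biasedExp p S fun A => (1 - p) * f A + p * f (insert a A) := by
  unfold biasedExp
  rw [Finset.sum_powerset_insert ha, ← Finset.sum_add_distrib]
  refine Finset.sum_congr rfl fun A hA => ?_
  have hAS := Finset.mem_powerset.1 hA
  have hle := Finset.card_le_card hAS
  rw [Finset.card_insert_of_notMem ha, Finset.card_insert_of_notMem fun h => ha (hAS h),
    Nat.add_sub_add_right, Nat.sub_add_comm hle, pow_succ, pow_succ]
  ring

/-- The expectation of an indicator is the measure of the family. -/
theorem biasedExp_indicator {n : ℕ} (p : ℝ) (𝓐 : Finset (Finset (Fin n))) :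
    biasedExp p Finset.univ (fun A => if A ∈ 𝓐 then 1 else 0) = biasedMeasure p 𝓐 := by
  simp [biasedExp, biasedMeasure, Finset.sum_ite_mem]

/-- The case of a one-point ground set of `biasedExp_mul_biasedExp_le`. -/
theorem two_point_mul_le {p r M c f₀ f₁ g₀ g₁ : ℝ} (hp : 0 ≤ p) (hpr : p ≤ r) (hr : r ≤ 1)
    (hM : 1 ≤ M) (hf₀ : 0 ≤ f₀) (hf₁ : 0 ≤ f₁) (hg₀ : 0 ≤ g₀) (hg₁ : 0 ≤ g₁)
    (h00 : f₀ * g₀ ≤ c) (h11 : f₁ * g₁ ≤ c) (h01 : f₀ * g₁ ≤ c) (h10 : f₁ * g₀ ≤ c * M) :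
    ((1 - p) * f₀ + p * f₁) * ((1 - r) * g₀ + r * g₁) ≤
      c * (1 + p * (1 - p) * (M + M⁻¹ - 2)) := by
  have hM0 : 0 < M := by linarith
  have hc : 0 ≤ c := (mul_nonneg hf₀ hg₀).trans h00
  have hp1 : 0 ≤ 1 - p := by linarith
  have hpq : 0 ≤ p * (1 - p) := mul_nonneg hp hp1
  have hMM : 2 ≤ M + M⁻¹ := by
    have : M + M⁻¹ - 2 = (M - 1) ^ 2 / M := by field_simp; ring
    have : 0 ≤ (M - 1) ^ 2 / M := by positivity
    linarith
  have hc2 : c * 2 ≤ c * (M + M⁻¹) := mul_le_mul_of_nonneg_left hMM hc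
  -- If `g₁ ≤ g₀`, lowering `r` to `p` only increases the mean of `g`. Otherwise `f₁ * g₀ ≤ f₁ *
  -- g₁`, so all four products are at most `c`.
  rcases le_total g₁ g₀ with hg | hg
  · have hcross : f₁ * g₀ + f₀ * g₁ ≤ c * (M + M⁻¹) := by
      rcases le_or_gt (f₁ * g₀) c with hx | hx
      · linarith
      · have hx0 : 0 < f₁ * g₀ := hc.trans_lt hx
        have hxy : (f₁ * g₀) * (f₀ * g₁) ≤ c * c := by
          calc (f₁ * g₀) * (f₀ * g₁) = (f₀ * g₀) * (f₁ * g₁) := by ring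
            _ ≤ c * c := mul_le_mul h00 h11 (mul_nonneg hf₁ hg₁) hc
        have hcM : c * M⁻¹ ≤ f₁ * g₀ :=
          (mul_le_of_le_one_right hc (inv_le_one_of_one_le₀ hM)).trans hx.le
        -- With `x = f₁ * g₀` in `[c / M, c * M]`, this product gives `x ^ 2 + c ^ 2 ≤ c * (M + M⁻¹)
        -- * x`.
        have hprod := mul_nonneg (sub_nonneg.2 h10) (sub_nonneg.2 hcM)
        have hMi : M * M⁻¹ = 1 := mul_inv_cancel₀ hM0.ne'
        have : (c * M) * (c * M⁻¹) = c * c := by linear_combination c * c * hMi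
        refine le_of_mul_le_mul_left ?_ hx0
        nlinarith
    have hmono : (1 - r) * g₀ + r * g₁ ≤ (1 - p) * g₀ + p * g₁ := by
      nlinarith [mul_nonneg (sub_nonneg.2 hpr) (sub_nonneg.2 hg)]
    calc ((1 - p) * f₀ + p * f₁) * ((1 - r) * g₀ + r * g₁)
        ≤ ((1 - p) * f₀ + p * f₁) * ((1 - p) * g₀ + p * g₁) :=
          mul_le_mul_of_nonneg_left hmono (by positivity)
      _ = (1 - p) ^ 2 * (f₀ * g₀) + p ^ 2 * (f₁ * g₁) +
            p * (1 - p) * (f₁ * g₀ + f₀ * g₁) := by ring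
      _ ≤ (1 - p) ^ 2 * c + p ^ 2 * c + p * (1 - p) * (c * (M + M⁻¹)) := by gcongr
      _ = _ := by ring
  · have h1 : f₁ * g₀ ≤ c := (mul_le_mul_of_nonneg_left hg hf₁).trans h11
    have hr0 : 0 ≤ r := hp.trans hpr
    have hr1 : 0 ≤ 1 - r := by linarith
    calc ((1 - p) * f₀ + p * f₁) * ((1 - r) * g₀ + r * g₁)
        = (1 - p) * (1 - r) * (f₀ * g₀) + p * (1 - r) * (f₁ * g₀) +
            (1 - p) * r * (f₀ * g₁) + p * r * (f₁ * g₁) := by ring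
      _ ≤ (1 - p) * (1 - r) * c + p * (1 - r) * c + (1 - p) * r * c + p * r * c := by gcongr
      _ = c := by ring
      _ ≤ _ := le_mul_of_one_le_right hc
          (le_add_of_nonneg_right (mul_nonneg hpq (by linarith)))

/-- A tensorized two-function inequality: if `f A * g B ≤ c * M ^ |A \ B|` for all `A, B ⊆ S`, then
the product of the expectations of `f` and `g` is at most `c` times a factor for each point. -/
theorem biasedExp_mul_biasedExp_le {ι : Type*} [DecidableEq ι] {p r M : ℝ} (hp : 0 ≤ p)
    (hpr : p ≤ r) (hr : r ≤ 1) (hM : 1 ≤ M) (S : Finset ι) :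
    ∀ (c : ℝ) (f g : Finset ι → ℝ), (∀ A, 0 ≤ f A) → (∀ B, 0 ≤ g B) →
      (∀ A ⊆ S, ∀ B ⊆ S, f A * g B ≤ c * M ^ (A \ B).card) →
      biasedExp p S f * biasedExp r S g ≤ c * (1 + p * (1 - p) * (M + M⁻¹ - 2)) ^ S.card := by
  induction S using Finset.induction_on with
  | empty =>
    intro c f g _ _ h
    simpa [biasedExp] using h ∅ subset_rfl ∅ subset_rfl
  | insert a S ha ih =>
    intro c f g hf hg h
    have hp1 : 0 ≤ 1 - p := by linarith
    have hr0 : 0 ≤ r := hp.trans hpr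
    have hr1 : 0 ≤ 1 - r := by linarith
    rw [biasedExp_insert p ha, biasedExp_insert r ha, Finset.card_insert_of_notMem ha, pow_succ',
      ← mul_assoc]
    -- Average out `a`; the constant `c` absorbs its factor. Only `a ∈ A`, `a ∉ B` costs an extra
    -- `M`.
    refine ih _ _ _
      (fun A => add_nonneg (mul_nonneg hp1 (hf _)) (mul_nonneg hp (hf _)))
      (fun B => add_nonneg (mul_nonneg hr1 (hg _)) (mul_nonneg hr0 (hg _))) ?_
    intro A hA B hB
    have haA : a ∉ A := fun h => ha (hA h)
    have haB : a ∉ B := fun h => ha (hB h)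
    have hA' := hA.trans (Finset.subset_insert a S)
    have hB' := hB.trans (Finset.subset_insert a S)
    have h00 := h A hA' B hB'
    have h01 := h A hA' _ (Finset.insert_subset_insert a hB)
    have h10 := h _ (Finset.insert_subset_insert a hA) B hB'
    have h11 := h _ (Finset.insert_subset_insert a hA) _ (Finset.insert_subset_insert a hB)
    rw [Finset.sdiff_insert_of_notMem haA] at h01
    rw [Finset.insert_sdiff_insert, Finset.sdiff_insert_of_notMem haA] at h11
    rw [Finset.insert_sdiff_of_notMem _ haB, Finset.card_insert_of_notMem (by simp [haA]),
      pow_succ, ← mul_assoc] at h10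
    calc _ ≤ _ := two_point_mul_le hp hpr hr hM (hf _) (hf _) (hg _) (hg _) h00 h11 h01 h10
      _ = _ := by ring

theorem biasedMeasure_nonneg {n : ℕ} {p : ℝ} (hp : 0 ≤ p) (hp1 : p ≤ 1)
    (𝓐 : Finset (Finset (Fin n))) : 0 ≤ biasedMeasure p 𝓐 :=
  Finset.sum_nonneg fun _ _ => mul_nonneg (pow_nonneg hp _) (pow_nonneg (sub_nonneg.2 hp1) _)

theorem biasedMeasure_le_one {n : ℕ} {p : ℝ} (hp : 0 ≤ p) (hp1 : p ≤ 1)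
    (𝓐 : Finset (Finset (Fin n))) : biasedMeasure p 𝓐 ≤ 1 := by
  calc biasedMeasure p 𝓐
      ≤ ∑ A ∈ (Finset.univ : Finset (Fin n)).powerset,
          p ^ A.card * (1 - p) ^ ((Finset.univ : Finset (Fin n)).card - A.card) := by
        rw [Finset.card_univ, Fintype.card_fin]
        exact Finset.sum_le_sum_of_subset_of_nonneg (fun A _ => by simp)
          fun _ _ _ => mul_nonneg (pow_nonneg hp _) (pow_nonneg (sub_nonneg.2 hp1) _)
    _ = 1 := by rw [Finset.sum_pow_mul_eq_add_pow]; simp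

/-- Complementing every set exchanges the `p`-biased and the `(1 - p)`-biased measure. -/
theorem biasedMeasure_image_compl {n : ℕ} (p : ℝ) (𝓐 : Finset (Finset (Fin n))) :
    biasedMeasure (1 - p) (𝓐.image compl) = biasedMeasure p 𝓐 := by
  unfold biasedMeasure
  rw [Finset.sum_image compl_injective.injOn]
  refine Finset.sum_congr rfl fun A _ => ?_
  have hle : A.card ≤ n := by simpa using Finset.card_le_univ A
  rw [Finset.card_compl, Fintype.card_fin, Nat.sub_sub_self hle, sub_sub_cancel, mul_comm]

/-- Put `x = s ^ 2 / 2 ≤ 1 / 8` in `exp x - 1 ≤ x + x ^ 2 ≤ 9 / 8 * x`. -/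
theorem Real.cosh_sub_one_le {s : ℝ} (hs : 0 ≤ s) (hs' : s ≤ 1 / 2) :
    Real.cosh s - 1 ≤ 9 / 16 * s ^ 2 := by
  have h1 := Real.cosh_le_exp_half_sq s
  have hs2 : s ^ 2 ≤ 1 / 4 := by nlinarith
  have h2 := Real.abs_exp_sub_one_sub_id_le (x := s ^ 2 / 2)
    (by rw [abs_of_nonneg (by positivity)]; linarith)
  have h3 := (abs_le.1 h2).2
  nlinarith [sq_nonneg s]

/-- Two families whose members satisfy `t ≤ |A \ B|` cannot both have large measure. -/
theorem biasedMeasure_mul_le_of_le_card_sdiff {n : ℕ} (hn : 0 < n) {p r t : ℝ} (hp : 0 < p)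
    (hp2 : p ≤ 1 / 2) (hpr : p ≤ r) (hr : r ≤ 1) (ht : 0 ≤ t) (htn : t ≤ p * n)
    (𝓕 𝓖 : Finset (Finset (Fin n))) (h : ∀ A ∈ 𝓕, ∀ B ∈ 𝓖, t ≤ ((A \ B).card : ℝ)) :
    biasedMeasure p 𝓕 * biasedMeasure r 𝓖 ≤ Real.exp (-(t ^ 2 / (6 * p * (1 - p) * n))) := by
  have hn' : (0 : ℝ) < n := by exact_mod_cast hn
  have hq : 0 < 1 - p := by linarith
  obtain ⟨v, hv⟩ : ∃ v, v = p * (1 - p) * n := ⟨_, rfl⟩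
  have hv0 : 0 < v := by rw [hv]; positivity
  -- Since `v ≥ p * n / 2 ≥ t / 2`, this keeps `s ≤ 1 / 2`; the exponent becomes `-23 / 128 * t ^ 2
  -- / v`, below `-1 / 6 * t ^ 2 / v`.
  obtain ⟨s, hs⟩ : ∃ s, s = t / (4 * v) := ⟨_, rfl⟩
  have hs0 : 0 ≤ s := by rw [hs]; positivity
  have hs1 : s ≤ 1 / 2 := by
    rw [hs, div_le_iff₀ (by positivity), hv]
    nlinarith [mul_pos hp hn']
  have key := biasedExp_mul_biasedExp_le hp.le hpr hr (Real.one_le_exp hs0)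
    (Finset.univ : Finset (Fin n)) (Real.exp (-(s * t)))
    (fun A => if A ∈ 𝓕 then 1 else 0) (fun B => if B ∈ 𝓖 then 1 else 0)
    (fun A => by positivity) (fun B => by positivity) (by
      intro A _ B _
      by_cases hA : A ∈ 𝓕
      · by_cases hB : B ∈ 𝓖
        · simp only [hA, hB, if_true, mul_one]
          rw [← Real.exp_nat_mul, ← Real.exp_add]
          refine Real.one_le_exp ?_
          nlinarith [h A hA B hB]
        · simp only [hB, if_false, mul_zero]; positivity
      · simp only [hA, if_false, zero_mul]; positivity)
  rw [biasedExp_indicator, biasedExp_indicator, Finset.card_univ, Fintype.card_fin,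
    ← Real.exp_neg] at key
  have hcosh : Real.exp s + Real.exp (-s) - 2 ≤ 9 / 8 * s ^ 2 := by
    have := Real.cosh_sub_one_le hs0 hs1
    rw [Real.cosh_eq] at this
    linarith
  have hcosh0 : 0 ≤ Real.exp s + Real.exp (-s) - 2 := by
    have := Real.one_le_cosh s
    rw [Real.cosh_eq] at this
    linarith
  have hK : (1 + p * (1 - p) * (Real.exp s + Real.exp (-s) - 2)) ^ n ≤
      Real.exp (9 / 8 * v * s ^ 2) := by
    calc _ ≤ Real.exp (p * (1 - p) * (9 / 8 * s ^ 2)) ^ n := by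
          refine pow_le_pow_left₀ (by positivity) ?_ n
          have h1 : p * (1 - p) * (Real.exp s + Real.exp (-s) - 2) ≤
              p * (1 - p) * (9 / 8 * s ^ 2) := mul_le_mul_of_nonneg_left hcosh (by positivity)
          have h2 := Real.add_one_le_exp (p * (1 - p) * (9 / 8 * s ^ 2))
          linarith
      _ = _ := by rw [← Real.exp_nat_mul, hv]; ring_nf
  calc _ ≤ _ := key
    _ ≤ Real.exp (-(s * t)) * Real.exp (9 / 8 * v * s ^ 2) := by gcongr
    _ ≤ _ := by
      rw [← Real.exp_add, Real.exp_le_exp]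
      have e1 : t ^ 2 / (6 * p * (1 - p) * n) = t ^ 2 / v * (1 / 6) := by
        rw [hv]; field_simp
      have e2 : -(s * t) + 9 / 8 * v * s ^ 2 = t ^ 2 / v * (-23 / 128) := by
        rw [hs]; field_simp; ring
      rw [e1, e2]
      have : 0 ≤ t ^ 2 / v := by positivity
      linarith

/-- A Chernoff bound for the lower tail of the size of a `p`-biased random set. -/
theorem biasedMeasure_le_of_card_le {n : ℕ} (hn : 0 < n) {p t : ℝ} (hp : 0 < p)
    (hp2 : p ≤ 1 / 2) (ht : 0 ≤ t) (htn : t ≤ p * n)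
    (𝓕 : Finset (Finset (Fin n))) (h : ∀ A ∈ 𝓕, (A.card : ℝ) ≤ p * n - t) :
    biasedMeasure p 𝓕 ≤ Real.exp (-(t ^ 2 / (4 * p * (1 - p) * n))) := by
  have hn' : (0 : ℝ) < n := by exact_mod_cast hn
  have hq : 0 < 1 - p := by linarith
  obtain ⟨v, hv⟩ : ∃ v, v = p * (1 - p) * n := ⟨_, rfl⟩
  have hv0 : 0 < v := by rw [hv]; positivity
  -- The minimizer of `-s * t + v * s ^ 2`.
  obtain ⟨s, hs⟩ : ∃ s, s = t / (2 * v) := ⟨_, rfl⟩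
  have hs0 : 0 ≤ s := by rw [hs]; positivity
  have hs1 : s ≤ 1 := by
    rw [hs, div_le_iff₀ (by positivity), hv]
    nlinarith [mul_pos hp hn']
  have hmarkov : biasedMeasure p 𝓕 ≤
      Real.exp (s * (p * n - t)) * (p * Real.exp (-s) + (1 - p)) ^ n := by
    have hsum := Finset.sum_pow_mul_eq_add_pow (p * Real.exp (-s)) (1 - p)
      (Finset.univ : Finset (Fin n))
    rw [Finset.card_univ, Fintype.card_fin] at hsum
    rw [← hsum, Finset.mul_sum]
    calc biasedMeasure p 𝓕
        ≤ ∑ A ∈ 𝓕, Real.exp (s * (p * n - t)) *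
            ((p * Real.exp (-s)) ^ A.card * (1 - p) ^ (n - A.card)) := by
          refine Finset.sum_le_sum fun A hA => ?_
          have h1 : 1 ≤ Real.exp (s * (p * n - t)) * Real.exp (-s) ^ A.card := by
            rw [← Real.exp_nat_mul, ← Real.exp_add]
            refine Real.one_le_exp ?_
            nlinarith [h A hA]
          calc p ^ A.card * (1 - p) ^ (n - A.card)
              ≤ p ^ A.card * (1 - p) ^ (n - A.card) *
                  (Real.exp (s * (p * n - t)) * Real.exp (-s) ^ A.card) :=
                le_mul_of_one_le_right (by positivity) h1
            _ = _ := by rw [mul_pow]; ring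
      _ ≤ _ := Finset.sum_le_sum_of_subset_of_nonneg (fun A _ => by simp)
          fun _ _ _ => by positivity
  have hexp : ∀ y : ℝ, |y| ≤ 1 → Real.exp y ≤ 1 + y + y ^ 2 := fun y hy => by
    have := (abs_le.1 (Real.abs_exp_sub_one_sub_id_le hy)).2
    linarith
  -- Centring at the mean cancels the linear terms and leaves the variance `p * (1 - p)`.
  have hpoint : Real.exp (s * p) * (p * Real.exp (-s) + (1 - p)) ≤
      Real.exp (p * (1 - p) * s ^ 2) := by
    have h1 := hexp (s * p) (by rw [abs_of_nonneg (by positivity)]; nlinarith)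
    have h2 := hexp (-(s * (1 - p))) (by
      rw [abs_neg, abs_of_nonneg (by positivity)]; nlinarith)
    have h3 := Real.add_one_le_exp (p * (1 - p) * s ^ 2)
    have h4 : Real.exp (s * p) * Real.exp (-s) = Real.exp (-(s * (1 - p))) := by
      rw [← Real.exp_add]; ring_nf
    calc Real.exp (s * p) * (p * Real.exp (-s) + (1 - p))
        = p * Real.exp (-(s * (1 - p))) + (1 - p) * Real.exp (s * p) := by rw [← h4]; ring
      _ ≤ p * (1 + -(s * (1 - p)) + (-(s * (1 - p))) ^ 2) +
            (1 - p) * (1 + s * p + (s * p) ^ 2) := by gcongr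
      _ = p * (1 - p) * s ^ 2 + 1 := by ring
      _ ≤ _ := h3
  calc _ ≤ _ := hmarkov
    _ = Real.exp (-(s * t)) * (Real.exp (s * p) * (p * Real.exp (-s) + (1 - p))) ^ n := by
      rw [mul_pow, ← Real.exp_nat_mul, ← mul_assoc, ← Real.exp_add]; ring_nf
    _ ≤ Real.exp (-(s * t)) * Real.exp (p * (1 - p) * s ^ 2) ^ n := by gcongr
    _ = _ := by
      rw [← Real.exp_nat_mul, ← Real.exp_add]
      congr 1
      rw [hs, hv]; field_simp; ring

theorem lemma3p3 (n : ℕ) (hn : 0 < n) (p p' : ℝ) (hp : 0 < p) (hpp' : p ≤ p')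
    (hp' : p' ≤ 1 - p) (hp2 : p ≤ 1 / 2) (α : ℕ) (hα : 0 < α) (hαn : (α : ℝ) ≤ p * n)
    (𝓕 𝓖 : Finset (Finset (Fin n))) :
    (Forbid n (Set.Icc 0 α) 𝓕 𝓖 →
      biasedMeasure p 𝓕 * biasedMeasure p' 𝓖 ≤
        Real.exp (-((α : ℝ) ^ 2 / (24 * p * (1 - p) * n)))) ∧
    (Forbid n {k : ℕ | p * n - α ≤ (k : ℝ) ∧ k ≤ n} 𝓕 𝓖 →
      biasedMeasure p 𝓕 * biasedMeasure p' 𝓖 ≤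
        2 * Real.exp (-((α : ℝ) ^ 2 / (24 * p * (1 - p) * n)))) := by
  have hn' : (0 : ℝ) < n := by exact_mod_cast hn
  have hα' : (0 : ℝ) < α := by exact_mod_cast hα
  have hq : 0 < 1 - p := by linarith
  have hp'0 : 0 ≤ p' := by linarith
  have hp'1 : p' ≤ 1 := by linarith
  refine ⟨fun h => ?_, fun h => ?_⟩
  · have key := biasedMeasure_mul_le_of_le_card_sdiff hn hp hp2 (r := 1 - p') (by linarith)
      (by linarith) hα'.le hαn 𝓕 (𝓖.image compl) (by
        intro A hA C hC
        obtain ⟨B, hB, rfl⟩ := Finset.mem_image.1 hC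
        have hAB : α < (A ∩ B).card := by
          by_contra hle
          exact h A hA B hB ⟨Nat.zero_le _, not_lt.1 hle⟩
        rw [sdiff_compl, Finset.inf_eq_inter]
        exact_mod_cast hAB.le)
    rw [biasedMeasure_image_compl] at key
    refine key.trans (Real.exp_le_exp.2 (neg_le_neg ?_))
    gcongr
    norm_num
  · have hcard : ∀ A ∈ 𝓕, ∀ B ∈ 𝓖, ((A ∩ B).card : ℝ) < p * n - α := by
      intro A hA B hB
      by_contra hle
      refine h A hA B hB ⟨not_lt.1 hle, ?_⟩
      simpa using Finset.card_le_univ (A ∩ B)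
    -- Cutting at `p * n - α / 2` leaves deviation `α / 2` on both sides; the large sets give the
    -- constant `24 = 6 * 2 ^ 2`.
    have hsmall := biasedMeasure_le_of_card_le hn hp hp2 (t := α / 2) (by positivity)
      (by linarith) (𝓕.filter fun A => (A.card : ℝ) ≤ p * n - α / 2)
      (fun A hA => (Finset.mem_filter.1 hA).2)
    have hlarge := biasedMeasure_mul_le_of_le_card_sdiff hn hp hp2 hpp' hp'1 (t := α / 2)
      (by positivity) (by linarith) (𝓕.filter fun A => ¬ (A.card : ℝ) ≤ p * n - α / 2) 𝓖 (by
        intro A hA B hB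
        obtain ⟨hA, hA'⟩ := Finset.mem_filter.1 hA
        have h1 := hcard A hA B hB
        have h2 : ((A \ B).card : ℝ) + (A ∩ B).card = A.card := by
          exact_mod_cast Finset.card_sdiff_add_card_inter A B
        linarith)
    have hsplit : biasedMeasure p 𝓕 =
        biasedMeasure p (𝓕.filter fun A => (A.card : ℝ) ≤ p * n - α / 2) +
          biasedMeasure p (𝓕.filter fun A => ¬ (A.card : ℝ) ≤ p * n - α / 2) :=
      (Finset.sum_filter_add_sum_filter_not 𝓕 _ _).symm
    have e1 : ((α : ℝ) / 2) ^ 2 / (6 * p * (1 - p) * n) =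
        (α : ℝ) ^ 2 / (24 * p * (1 - p) * n) := by field_simp; norm_num
    have e2 : (α : ℝ) ^ 2 / (24 * p * (1 - p) * n) ≤
        ((α : ℝ) / 2) ^ 2 / (4 * p * (1 - p) * n) := by
      rw [← e1]; gcongr; norm_num
    have hsmall' := (mul_le_of_le_one_right
      (biasedMeasure_nonneg hp.le (by linarith) _)
      (biasedMeasure_le_one hp'0 hp'1 𝓖)).trans
      (hsmall.trans (Real.exp_le_exp.2 (neg_le_neg e2)))
    rw [e1] at hlarge
    rw [hsplit, add_mul]
    linarith
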